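/- **Setting.** A numerical semigroup is a submonoid $\Lambda$ of $(\mathbb N,+)$, $\mathbb N=\{0,1,2,\dots\}$, with finite complement; its embedding dimension is the number of elements of its minimal system of generators. An ideal of $\Lambda$ is a subset $I\subseteq\Lambda$ with $I+\Lambda\subseteq I$; it is irreducible if it cannot be written as the intersection of two proper ideals (ideals different from $\Lambda$), each containing it properly. The graph $G_I(\Lambda)$ is the simple graph whose vertices are the nonzero elements of $\Lambda\setminus I$, where two distinct vertices $y,z$ are adjacent if and only if $y+z\in I$. Its order $|G_I(\Lambda)|$ is its number of vertices. A graph is planar if it can be drawn in the plane, with vertices as distinct points and edges as simple arcs joining their ends, so that no edge passes through a vertex other than its ends and two edges meet only at a vertex to which both are incident. A graph of order 6 is *of type $k$* ($1\le k\le 4$) if it is isomorphic to the graph on $\{0,\dots,5\}$ with the following edges (and degree sequence); $ij$ denotes the edge $\{i,j\}$: * type 1, $(1,2,3,3,4,5)$: $01,12,13,14,15,23,25,35,45$; * type 2, $(2,3,3,4,5,5)$: $01,04,12,13,14,15,24,25,34,35,45$; * type 3, $(2,3,4,4,4,5)$: $01,04,12,13,14,15,23,24,25,34,35$; * type 4,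 $(3,3,4,4,5,5)$: $01,02,03,04,05,12,13,14,15,25,34,35$. A graph of order 7 is *of type $k$* ($1\le k\le 3$) if it is isomorphic to the graph on $\{0,\dots,6\}$ with the following edges (and degree sequence): * type 1, $(1,2,3,3,4,5,6)$: $01,02,03,04,05,06,13,14,15,16,36,46$; * type 2, $(2,3,3,4,5,5,6)$: $01,02,04,05,06,12,15,16,23,24,25,26,35,45$; * type 3, $(3,3,3,5,5,5,6)$: $01,02,04,05,06,12,13,15,16,23,24,25,26,36,46$. **Theorem.** Let $\Lambda$ be a numerical semigroup of embedding dimension $n\ge 2$ and let $I$ be an irreducible ideal of $\Lambda$. Then $G_I(\Lambda)$ is planar if one of the following holds: 1. $|G_I(\Lambda)|\le 5$; 2. $|G_I(\Lambda)|=6$ and $G_I(\Lambda)$ is of type 1, 2, 3 or 4; 3. $|G_I(\Lambda)|=7$ and $G_I(\Lambda)$ is of type 1, 2 or 3. -/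

import Mathlib

namespace NumSemigroup

/-- A numerical semigroup: a submonoid of `ℕ` with finite complement. -/
def IsNumericalSemigroup (Λ : AddSubmonoid ℕ) : Prop :=
  ((Λ : Set ℕ)ᶜ).Finite

/-- The embedding dimension: the number of elements of the minimal system of generators, that is,
the least number of elements of a generating set. -/
noncomputable def embeddingDimension (Λ : AddSubmonoid ℕ) : ℕ :=
  sInf {n : ℕ | ∃ A : Finset ℕ, AddSubmonoid.closure (A : Set ℕ) = Λ ∧ A.card = n}

/-- An (integral) ideal of `Λ`: a subset `I` of `Λ` with `I + Λ ⊆ I`. -/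
def IsIdeal (Λ : AddSubmonoid ℕ) (I : Set ℕ) : Prop :=
  I ⊆ (Λ : Set ℕ) ∧ ∀ i ∈ I, ∀ s ∈ Λ, i + s ∈ I

/-- An irreducible ideal: an ideal that is not the intersection of two proper ideals each of which
contains it properly. -/
def IsIrreducibleIdeal (Λ : AddSubmonoid ℕ) (I : Set ℕ) : Prop :=
  IsIdeal Λ I ∧
    ¬ ∃ J K : Set ℕ, IsIdeal Λ J ∧ IsIdeal Λ K ∧ J ≠ (Λ : Set ℕ) ∧ K ≠ (Λ : Set ℕ) ∧
      I ⊂ J ∧ I ⊂ K ∧ I = J ∩ K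

/-- The vertices of the graph of an ideal: the nonzero elements of `Λ \ I`. -/
abbrev Vertex (Λ : AddSubmonoid ℕ) (I : Set ℕ) : Type :=
  {y : ℕ // y ∈ (Λ : Set ℕ) \ I ∧ y ≠ 0}

/-- The graph `G_I(Λ)`: distinct vertices `y`, `z` are adjacent if and only if `y + z ∈ I`. -/
def idealGraph (Λ : AddSubmonoid ℕ) (I : Set ℕ) : SimpleGraph (Vertex Λ I) where
  Adj y z := y ≠ z ∧ (y : ℕ) + (z : ℕ) ∈ I
  symm := ⟨fun _ _ h => ⟨h.1.symm, by rw [add_comm]; exact h.2⟩⟩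
  loopless := ⟨fun _ h => h.1 rfl⟩

/-- A graph is planar if it can be drawn in the plane without crossings: vertices are distinct
points, each edge is a simple arc joining its two ends, an edge passes through no vertex other than
its ends, and two different edges meet only at a vertex to which both are incident. -/
def IsPlanar {V : Type*} (G : SimpleGraph V) : Prop :=
  ∃ (pos : V → EuclideanSpace ℝ (Fin 2))
    (arc : G.edgeSet → unitInterval → EuclideanSpace ℝ (Fin 2)),
    Function.Injective pos ∧
    (∀ e : G.edgeSet, Continuous (arc e) ∧ Function.Injective (arc e)) ∧
    (∀ e : G.edgeSet, Sym2.map pos (e : Sym2 V) = s(arc e 0, arc e 1)) ∧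
    (∀ (e : G.edgeSet) (v : V), pos v ∈ Set.range (arc e) → v ∈ (e : Sym2 V)) ∧
    (∀ e f : G.edgeSet, e ≠ f → ∀ p ∈ Set.range (arc e) ∩ Set.range (arc f),
      ∃ v : V, v ∈ (e : Sym2 V) ∧ v ∈ (f : Sym2 V) ∧ pos v = p)

/-- Order 6, type 1; degree sequence (1, 2, 3, 3, 4, 5). -/
def sixType1 : SimpleGraph (Fin 6) :=
  SimpleGraph.fromEdgeSet
    {s(0, 1), s(1, 2), s(1, 3), s(1, 4), s(1, 5), s(2, 3), s(2, 5), s(3, 5), s(4, 5)}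

/-- Order 6, type 2; degree sequence (2, 3, 3, 4, 5, 5). -/
def sixType2 : SimpleGraph (Fin 6) :=
  SimpleGraph.fromEdgeSet
    {s(0, 1), s(0, 4), s(1, 2), s(1, 3), s(1, 4), s(1, 5), s(2, 4), s(2, 5), s(3, 4), s(3, 5),
      s(4, 5)}

/-- Order 6, type 3; degree sequence (2, 3, 4, 4, 4, 5). -/
def sixType3 : SimpleGraph (Fin 6) :=
  SimpleGraph.fromEdgeSet
    {s(0, 1), s(0, 4), s(1, 2), s(1, 3), s(1, 4), s(1, 5), s(2, 3), s(2, 4), s(2, 5), s(3, 4),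
      s(3, 5)}

/-- Order 6, type 4; degree sequence (3, 3, 4, 4, 5, 5). -/
def sixType4 : SimpleGraph (Fin 6) :=
  SimpleGraph.fromEdgeSet
    {s(0, 1), s(0, 2), s(0, 3), s(0, 4), s(0, 5), s(1, 2), s(1, 3), s(1, 4), s(1, 5), s(2, 5),
      s(3, 4), s(3, 5)}

/-- Order 7, type 1; degree sequence (1, 2, 3, 3, 4, 5, 6). -/
def sevenType1 : SimpleGraph (Fin 7) :=
  SimpleGraph.fromEdgeSet
    {s(0, 1), s(0, 2), s(0, 3), s(0, 4), s(0, 5), s(0, 6), s(1, 3), s(1, 4), s(1, 5), s(1, 6),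
      s(3, 6), s(4, 6)}

/-- Order 7, type 2; degree sequence (2, 3, 3, 4, 5, 5, 6). -/
def sevenType2 : SimpleGraph (Fin 7) :=
  SimpleGraph.fromEdgeSet
    {s(0, 1), s(0, 2), s(0, 4), s(0, 5), s(0, 6), s(1, 2), s(1, 5), s(1, 6), s(2, 3), s(2, 4),
      s(2, 5), s(2, 6), s(3, 5), s(4, 5)}

/-- Order 7, type 3; degree sequence (3, 3, 3, 5, 5, 5, 6). -/
def sevenType3 : SimpleGraph (Fin 7) :=
  SimpleGraph.fromEdgeSet
    {s(0, 1), s(0, 2), s(0, 4), s(0, 5), s(0, 6), s(1, 2), s(1, 3), s(1, 5), s(1, 6), s(2, 3),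
      s(2, 4), s(2, 5), s(2, 6), s(3, 6), s(4, 6)}

/-- `G` is isomorphic to `H`. -/
def IsOfType {V W : Type*} (G : SimpleGraph V) (H : SimpleGraph W) : Prop :=
  Nonempty (G ≃g H)

end NumSemigroup

/-!
Let `I` be irreducible with `Λ \ I` finite. If `m ∉ I` is maximal for the relation
`x ≤ y ↔ y ∈ x + Λ`, then `I ∪ {m}` is an ideal, and two distinct such ideals would meet in `I`.
So there is a single maximal `m`, and every vertex `x` has a complement `s ∈ Λ` with `x + s = m`.
As `m ∉ I`, a vertex is never adjacent to its complement; if the graph is complete, this leaves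
only `2 x = m` for each vertex `x ≠ m`, hence at most two vertices. A graph of order 5 is therefore
contained in `K₅` minus an edge, and one of smaller order is contained in `K₄`. These two graphs and
the seven listed types are drawn with straight edges between lattice points, where the absence of
crossings reduces to the signs of finitely many integer determinants.
-/

namespace NumSemigroup

open SimpleGraph
open scoped Convex

section Segment

variable {𝕜 E : Type*} [Field 𝕜] [LinearOrder 𝕜] [IsStrictOrderedRing 𝕜] [AddCommGroup E]
  [Module 𝕜 E]

theorem disjoint_segment_of_mul_pos (f : E →ᵃ[𝕜] 𝕜) {a b c d : E} (ha : f a = 0) (hb : f b = 0)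
    (hcd : 0 < f c * f d) : Disjoint [a -[𝕜] b] [c -[𝕜] d] := by
  suffices Disjoint (f '' [a -[𝕜] b]) (f '' [c -[𝕜] d]) from this.of_image
  rw [image_segment, image_segment, ha, hb, segment_same, Set.disjoint_singleton_left,
    segment_eq_uIcc, Set.mem_uIcc]
  rcases pos_and_pos_or_neg_and_neg_of_mul_pos hcd with ⟨hc, hd⟩ | ⟨hc, hd⟩ <;> grind

theorem segment_inter_segment_subset_singleton {a b d : E} (hb : b ∉ [a -[𝕜] d])
    (hd : d ∉ [a -[𝕜] b]) : [a -[𝕜] b] ∩ [a -[𝕜] d] ⊆ {a} := by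
  rintro x ⟨hxb, hxd⟩
  rw [mem_segment_iff_wbtw] at hb hd hxb hxd
  by_contra! hxa
  have hray : SameRay 𝕜 (b - a) (d - a) :=
    hxb.sameRay_vsub_left.symm.trans hxd.sameRay_vsub_left
      fun h => absurd (sub_eq_zero.mp h) hxa
  exact (wbtw_total_of_sameRay_vsub_left hray).elim hb hd

end Segment

section StraightLineDrawing

variable {V E : Type*} [AddCommGroup E] [Module ℝ E] {G : SimpleGraph V} {pos : V → E}

/-- The image of the edge `e` in the straight-line drawing of a graph that places each vertex `v`
at `pos v`, written as a convex hull so as not to depend on an orientation of `e`. -/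
def edgeSegment (pos : V → E) (e : Sym2 V) : Set E :=
  convexHull ℝ (pos '' e)

theorem edgeSegment_mk (pos : V → E) (a b : V) :
    edgeSegment pos s(a, b) = [pos a -[ℝ] pos b] := by
  rw [edgeSegment, Sym2.coe_mk, Set.image_pair, convexHull_pair]

/-- The placement `pos` of the vertices gives a drawing of `G` by straight segments without
crossings. Segments that share an end are not mentioned: they cannot overlap as no vertex lies on
an edge not incident to it. -/
structure IsStraightLineDrawing (G : SimpleGraph V) (pos : V → E) : Prop where
  injective : Function.Injective pos
  mem_of_mem_edgeSegment : ∀ e ∈ G.edgeSet, ∀ v, pos v ∈ edgeSegment pos e → v ∈ e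
  disjoint_edgeSegment : ∀ e ∈ G.edgeSet, ∀ f ∈ G.edgeSet, Disjoint (e : Set V) f →
    Disjoint (edgeSegment pos e) (edgeSegment pos f)

theorem IsStraightLineDrawing.exists_common_vertex (h : IsStraightLineDrawing G pos)
    {e f : Sym2 V} (he : e ∈ G.edgeSet) (hf : f ∈ G.edgeSet) (hef : e ≠ f) {x : E}
    (hxe : x ∈ edgeSegment pos e) (hxf : x ∈ edgeSegment pos f) :
    ∃ v ∈ e, v ∈ f ∧ pos v = x := by
  obtain ⟨a, hae, haf⟩ : ∃ a ∈ e, a ∈ f := by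
    by_contra! hdisj
    exact Set.disjoint_left.mp
      (h.disjoint_edgeSegment e he f hf (Set.disjoint_left.mpr hdisj)) hxe hxf
  refine ⟨a, hae, haf, ?_⟩
  obtain ⟨b, rfl⟩ := hae
  obtain ⟨d, rfl⟩ := haf
  have hb := h.mem_of_mem_edgeSegment _ hf b
  have hd := h.mem_of_mem_edgeSegment _ he d
  have hab : G.Adj a b := he
  have had : G.Adj a d := hf
  simp only [edgeSegment_mk] at hxe hxf hb hd
  refine (segment_inter_segment_subset_singleton (fun hmem => ?_) (fun hmem => ?_)
    ⟨hxe, hxf⟩).symm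
  · rcases Sym2.mem_iff.mp (hb hmem) with rfl | rfl
    exacts [hab.ne rfl, hef rfl]
  · rcases Sym2.mem_iff.mp (hd hmem) with rfl | rfl
    exacts [had.ne rfl, hef rfl]

theorem exists_arc_range_eq_edgeSegment [TopologicalSpace E] [ContinuousAdd E]
    [ContinuousSMul ℝ E] (hpos : Function.Injective pos) {e : Sym2 V} (he : ¬ e.IsDiag) :
    ∃ γ : unitInterval → E, (Continuous γ ∧ Function.Injective γ) ∧
      e.map pos = s(γ 0, γ 1) ∧ Set.range γ = edgeSegment pos e := by
  induction e with | _ a b =>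
  have hab : pos a ≠ pos b := fun h => he (hpos h)
  let γ := Path.segment (pos a) (pos b)
  have hγ : Function.Injective γ :=
    (AffineMap.lineMap_injective ℝ hab).comp Subtype.val_injective
  exact ⟨γ, ⟨γ.continuous, hγ⟩, by simp, by simp [γ, edgeSegment_mk]⟩

theorem IsStraightLineDrawing.isPlanar {pos : V → EuclideanSpace ℝ (Fin 2)}
    (h : IsStraightLineDrawing G pos) : IsPlanar G := by
  choose arc harc hends hrange using fun e : G.edgeSet =>
    exists_arc_range_eq_edgeSegment h.injective (G.not_isDiag_of_mem_edgeSet e.2)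
  refine ⟨pos, arc, h.injective, harc, hends, fun e v hv => ?_, fun e f hef x ⟨hxe, hxf⟩ => ?_⟩
  · exact h.mem_of_mem_edgeSegment e e.2 v (hrange e ▸ hv)
  · exact h.exists_common_vertex e.2 f.2 (Subtype.coe_ne_coe.mpr hef)
      (hrange e ▸ hxe) (hrange f ▸ hxf)

end StraightLineDrawing

section LatticeDrawing

variable {V : Type*} {G : SimpleGraph V} {p : V → ℤ × ℤ}

/-- Twice the signed area of the triangle `abc`: its sign tells on which side of the line `ab` the
point `c` lies. -/
def orient (a b c : ℤ × ℤ) : ℤ :=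
  (b.1 - a.1) * (c.2 - a.2) - (b.2 - a.2) * (c.1 - a.1)

/-- A sufficient criterion, decidable for finite graphs, for the placement `p` of the vertices at
lattice points to give a drawing of `G` by straight segments without crossings: no vertex lies on
the line through an edge not incident to it, and of two edges without a common end, one lies
strictly on one side of the line through the other. -/
def IsLatticeDrawing (G : SimpleGraph V) (p : V → ℤ × ℤ) : Prop :=
  Function.Injective p ∧
  (∀ a b, G.Adj a b → ∀ v, v ≠ a → v ≠ b → orient (p a) (p b) (p v) ≠ 0) ∧
  ∀ a b, G.Adj a b → ∀ c d, G.Adj c d → (a ≠ c ∧ a ≠ d ∧ b ≠ c ∧ b ≠ d) →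
    0 < orient (p a) (p b) (p c) * orient (p a) (p b) (p d) ∨
    0 < orient (p c) (p d) (p a) * orient (p c) (p d) (p b)

set_option synthInstance.maxSize 2000 in
instance [Fintype V] [DecidableEq V] [DecidableRel G.Adj] : Decidable (IsLatticeDrawing G p) := by
  unfold IsLatticeDrawing
  infer_instance

/-- The lattice point `z` as a point of the Euclidean plane. -/
noncomputable def latticePoint (z : ℤ × ℤ) : EuclideanSpace ℝ (Fin 2) :=
  !₂[(z.1 : ℝ), (z.2 : ℝ)]

theorem latticePoint_injective : Function.Injective latticePoint := fun y z h =>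
  Prod.ext (by simpa [latticePoint] using congrArg (fun x => x 0) h)
    (by simpa [latticePoint] using congrArg (fun x => x 1) h)

theorem exists_affineMap_latticePoint_eq_orient (a b : ℤ × ℤ) :
    ∃ f : EuclideanSpace ℝ (Fin 2) →ᵃ[ℝ] ℝ, ∀ c, f (latticePoint c) = orient a b c := by
  let x := (EuclideanSpace.proj (𝕜 := ℝ) (0 : Fin 2)).toLinearMap.toAffineMap
  let y := (EuclideanSpace.proj (𝕜 := ℝ) (1 : Fin 2)).toLinearMap.toAffineMap
  refine ⟨((b.1 - a.1 : ℤ) : ℝ) • (y - AffineMap.const ℝ _ (a.2 : ℝ)) -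
    ((b.2 - a.2 : ℤ) : ℝ) • (x - AffineMap.const ℝ _ (a.1 : ℝ)), fun c => ?_⟩
  simp [latticePoint, orient, x, y]

theorem disjoint_segment_latticePoint {a b c d : ℤ × ℤ} (h : 0 < orient a b c * orient a b d) :
    Disjoint [latticePoint a -[ℝ] latticePoint b] [latticePoint c -[ℝ] latticePoint d] := by
  obtain ⟨f, hf⟩ := exists_affineMap_latticePoint_eq_orient a b
  refine disjoint_segment_of_mul_pos f ?_ ?_ ?_ <;> simp only [hf]
  · simp [orient]
  · simp [orient, mul_comm]
  · exact_mod_cast h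

theorem IsLatticeDrawing.isStraightLineDrawing (h : IsLatticeDrawing G p) :
    IsStraightLineDrawing G (latticePoint ∘ p) where
  injective := latticePoint_injective.comp h.1
  mem_of_mem_edgeSegment := by
    rintro ⟨a, b⟩ hab v hv
    by_contra! hvab
    obtain ⟨hva, hvb⟩ := not_or.mp (Sym2.mem_iff.not.mp hvab)
    have := disjoint_segment_latticePoint (mul_self_pos.mpr (h.2.1 a b hab v hva hvb))
    rw [segment_same, Set.disjoint_singleton_right] at this
    exact this (edgeSegment_mk (latticePoint ∘ p) a b ▸ hv)
  disjoint_edgeSegment := by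
    rintro ⟨a, b⟩ hab ⟨c, d⟩ hcd hdisj
    have hne : a ≠ c ∧ a ≠ d ∧ b ≠ c ∧ b ≠ d := by
      simpa [Set.disjoint_left, and_assoc, not_or] using hdisj
    change Disjoint (edgeSegment _ s(a, b)) (edgeSegment _ s(c, d))
    rw [edgeSegment_mk, edgeSegment_mk]
    rcases h.2.2 a b hab c d hcd hne with hab_sep | hcd_sep
    · exact disjoint_segment_latticePoint hab_sep
    · exact (disjoint_segment_latticePoint hcd_sep).symm

theorem IsLatticeDrawing.isPlanar (h : IsLatticeDrawing G p) : IsPlanar G :=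
  h.isStraightLineDrawing.isPlanar

end LatticeDrawing

section SmallGraphs

instance : DecidableRel sixType1.Adj := by unfold sixType1; infer_instance

theorem isPlanar_sixType1 : IsPlanar sixType1 :=
  IsLatticeDrawing.isPlanar (p := ![(3, 3), (1, 2), (2, 2), (4, 3), (1, 0), (3, 0)])
    (by decide +kernel)

instance : DecidableRel sixType2.Adj := by unfold sixType2; infer_instance

theorem isPlanar_sixType2 : IsPlanar sixType2 :=
  IsLatticeDrawing.isPlanar (p := ![(2, 0), (0, 0), (2, 2), (1, 4), (4, 3), (1, 2)])
    (by decide +kernel)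

instance : DecidableRel sixType3.Adj := by unfold sixType3; infer_instance

theorem isPlanar_sixType3 : IsPlanar sixType3 :=
  IsLatticeDrawing.isPlanar (p := ![(0, 2), (2, 0), (1, 3), (4, 2), (0, 4), (2, 1)])
    (by decide +kernel)

instance : DecidableRel sixType4.Adj := by unfold sixType4; infer_instance

theorem isPlanar_sixType4 : IsPlanar sixType4 :=
  IsLatticeDrawing.isPlanar (p := ![(0, 3), (3, 1), (2, 2), (4, 4), (3, 0), (2, 3)])
    (by decide +kernel)

instance : DecidableRel sevenType1.Adj := by unfold sevenType1; infer_instance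

theorem isPlanar_sevenType1 : IsPlanar sevenType1 :=
  IsLatticeDrawing.isPlanar (p := ![(0, 0), (4, 2), (1, 3), (2, 4), (1, 1), (3, 1), (2, 3)])
    (by decide +kernel)

instance : DecidableRel sevenType2.Adj := by unfold sevenType2; infer_instance

theorem isPlanar_sevenType2 : IsPlanar sevenType2 :=
  IsLatticeDrawing.isPlanar (p := ![(2, 3), (6, 4), (0, 7), (8, 4), (1, 3), (1, 2), (2, 5)])
    (by decide +kernel)

instance : DecidableRel sevenType3.Adj := by unfold sevenType3; infer_instance

theorem isPlanar_sevenType3 : IsPlanar sevenType3 :=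
  IsLatticeDrawing.isPlanar (p := ![(9, 4), (4, 4), (12, 1), (0, 2), (10, 5), (7, 3), (9, 11)])
    (by decide +kernel)

theorem isPlanar_completeGraph_fin_four : IsPlanar (completeGraph (Fin 4)) :=
  IsLatticeDrawing.isPlanar (p := ![(0, 0), (3, 0), (0, 3), (1, 1)]) (by decide +kernel)

theorem isPlanar_completeGraph_fin_five_deleteEdges :
    IsPlanar ((completeGraph (Fin 5)).deleteEdges {s(3, 4)}) :=
  IsLatticeDrawing.isPlanar (p := ![(2, 1), (4, 4), (4, 0), (0, 0), (3, 2)]) (by decide +kernel)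

variable {V W : Type*} {G : SimpleGraph V} {H : SimpleGraph W}

theorem IsPlanar.of_isContained (hH : IsPlanar H) (hGH : G ⊑ H) : IsPlanar G := by
  obtain ⟨pos, arc, hpos, harc, hends, hvert, hcross⟩ := hH
  obtain ⟨f⟩ := hGH
  refine ⟨pos ∘ f, fun e => arc (f.mapEdgeSet e), hpos.comp f.injective, fun e => harc _,
    fun e => ?_, fun e v hv => ?_, fun e g heg x hx => ?_⟩
  · rw [← hends, ← Sym2.map_map]
    rfl
  · obtain ⟨u, hu, huv⟩ := Sym2.mem_map.mp (hvert (f.mapEdgeSet e) (f v) hv)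
    rwa [← f.injective huv]
  · obtain ⟨w, hwe, hwg, rfl⟩ := hcross _ _ (f.mapEdgeSet.injective.ne heg) x hx
    obtain ⟨u, hu, rfl⟩ := Sym2.mem_map.mp hwe
    obtain ⟨v, hv, huv⟩ := Sym2.mem_map.mp hwg
    exact ⟨u, hu, f.injective huv ▸ hv, rfl⟩

theorem IsPlanar.of_isOfType (hH : IsPlanar H) (hGH : IsOfType G H) : IsPlanar G :=
  hH.of_isContained (hGH.elim Iso.isContained)

theorem isPlanar_of_card_le_four [Finite V] (h : Nat.card V ≤ 4) (G : SimpleGraph V) :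
    IsPlanar G := by
  have := Fintype.ofFinite V
  exact isPlanar_completeGraph_fin_four.of_isContained <| isContained_top_iff.mpr <|
    Function.Embedding.nonempty_of_card_le (by simpa using h)

theorem exists_equiv_fin_apply_eq {n : ℕ} (h : Nat.card V = n) {u v : V} (huv : u ≠ v)
    {i j : Fin n} (hij : i ≠ j) : ∃ e : V ≃ Fin n, e u = i ∧ e v = j := by
  have : Finite V := Nat.finite_of_card_ne_zero (h ▸ i.pos.ne')
  have e := Finite.equivFinOfCardEq h
  obtain ⟨σ, hσu, hσv⟩ := MulAction.is_two_pretransitive_iff.mp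
    (Equiv.Perm.isMultiplyPretransitive (Fin n) 2) (e.injective.ne huv) hij
  exact ⟨e.trans σ, hσu, hσv⟩

theorem isPlanar_of_card_eq_five_of_ne_top (h : Nat.card V = 5) (hG : G ≠ ⊤) :
    IsPlanar G := by
  obtain ⟨u, v, huv, hadj⟩ := ne_top_iff_exists_not_adj.mp hG
  obtain ⟨e, hu, hv⟩ := exists_equiv_fin_apply_eq h huv (show (3 : Fin 5) ≠ 4 by decide)
  have hmap {a b : V} (hab : G.Adj a b) :
      ((completeGraph (Fin 5)).deleteEdges {s(3, 4)}).Adj (e a) (e b) := by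
    refine deleteEdges_adj.mpr ⟨e.injective.ne hab.ne, fun hmem => hadj ?_⟩
    have : s(a, b) = s(u, v) := Sym2.map.injective e.injective (by simpa [hu, hv] using hmem)
    rwa [← mem_edgeSet, ← this]
  exact isPlanar_completeGraph_fin_five_deleteEdges.of_isContained
    ⟨⟨⟨e, hmap⟩, e.injective⟩⟩

end SmallGraphs

section IrreducibleIdeal

variable {Λ : AddSubmonoid ℕ} {I : Set ℕ}

theorem IsIdeal.insert_vertex (hI : IsIdeal Λ I) {m : Vertex Λ I}
    (h : ∀ z : Vertex Λ I, (m : ℕ) + z ∈ I) : IsIdeal Λ (insert (m : ℕ) I) := by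
  refine ⟨Set.insert_subset m.2.1.1 hI.1, ?_⟩
  rintro i (rfl | hi) s hs
  · by_cases hs0 : s = 0
    · exact .inl (by simp [hs0])
    by_cases hsI : s ∈ I
    · exact .inr (add_comm s m ▸ hI.2 s hsI m m.2.1.1)
    · exact .inr (h ⟨s, ⟨hs, hsI⟩, hs0⟩)
  · exact .inr (hI.2 i hi s hs)

theorem IsIdeal.zero_notMem (hI : IsIdeal Λ I) (v : Vertex Λ I) : 0 ∉ I :=
  fun h => v.2.1.2 (zero_add (v : ℕ) ▸ hI.2 0 h v v.2.1.1)

theorem IsIrreducibleIdeal.eq_of_isIdeal_insert (hI : IsIrreducibleIdeal Λ I) {y z : Vertex Λ I}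
    (hy : IsIdeal Λ (insert (y : ℕ) I)) (hz : IsIdeal Λ (insert (z : ℕ) I)) : y = z := by
  by_contra hne
  have hproper (x : Vertex Λ I) : insert (x : ℕ) I ≠ Λ := fun h => by
    have hmem : 0 ∈ insert (x : ℕ) I := h.symm ▸ Λ.zero_mem
    exact hmem.elim (x.2.2 ·.symm) (hI.1.zero_notMem x)
  refine hI.2 ⟨_, _, hy, hz, hproper y, hproper z, Set.ssubset_insert y.2.1.2,
    Set.ssubset_insert z.2.1.2, ?_⟩
  grind [Subtype.ext_iff]

theorem IsIdeal.exists_add_eq_isIdeal_insert [Finite (Vertex Λ I)] (hI : IsIdeal Λ I)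
    (x : Vertex Λ I) :
    ∃ m : Vertex Λ I, (∃ s ∈ Λ, (x : ℕ) + s = m) ∧ IsIdeal Λ (insert (m : ℕ) I) := by
  obtain ⟨m, ⟨s, hs, hsm⟩, hmax⟩ :=
    (Set.toFinite {m : Vertex Λ I | ∃ s ∈ Λ, (x : ℕ) + s = m}).exists_maximal
      ⟨x, 0, Λ.zero_mem, add_zero _⟩
  refine ⟨m, ⟨s, hs, hsm⟩, hI.insert_vertex fun z => ?_⟩
  by_contra hmz
  have hz := z.2.2
  let w : Vertex Λ I := ⟨m + z, ⟨Λ.add_mem m.2.1.1 z.2.1.1, hmz⟩, by omega⟩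
  have hle : w ≤ m := hmax ⟨s + z, Λ.add_mem hs z.2.1.1, by simp [w, ← hsm, add_assoc]⟩
    (Subtype.coe_le_coe.mp (Nat.le_add_right _ _))
  have : (m : ℕ) + z ≤ m := hle
  omega

theorem IsIrreducibleIdeal.exists_forall_add_eq [Finite (Vertex Λ I)] [Nonempty (Vertex Λ I)]
    (hI : IsIrreducibleIdeal Λ I) :
    ∃ m : Vertex Λ I, ∀ x : Vertex Λ I, ∃ s ∈ Λ, (x : ℕ) + s = m := by
  obtain ⟨m, -, hm⟩ := hI.1.exists_add_eq_isIdeal_insert (Classical.arbitrary (Vertex Λ I))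
  refine ⟨m, fun x => ?_⟩
  obtain ⟨m', hxm', hm'⟩ := hI.1.exists_add_eq_isIdeal_insert x
  rwa [hI.eq_of_isIdeal_insert hm hm']

theorem IsIdeal.add_self_eq_of_idealGraph_eq_top (hI : IsIdeal Λ I)
    (hG : idealGraph Λ I = ⊤) {x m : Vertex Λ I} (hxm : x ≠ m) {s : ℕ} (hs : s ∈ Λ)
    (hadd : (x : ℕ) + s = m) : (x : ℕ) + x = m := by
  have hs0 : s ≠ 0 := fun h => hxm (Subtype.ext (by omega))
  have hsI : s ∉ I := fun h => m.2.1.2 (hadd ▸ add_comm s x ▸ hI.2 s h x x.2.1.1)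
  let y : Vertex Λ I := ⟨s, ⟨hs, hsI⟩, hs0⟩
  have hxy : x = y := by
    by_contra hne
    have hadj : (idealGraph Λ I).Adj x y := hG ▸ hne
    exact m.2.1.2 (hadd ▸ hadj.2)
  exact (congrArg (fun z : Vertex Λ I => (x : ℕ) + z) hxy).trans hadd

theorem IsIrreducibleIdeal.idealGraph_ne_top [Finite (Vertex Λ I)] (hI : IsIrreducibleIdeal Λ I)
    (hcard : 3 ≤ ENat.card (Vertex Λ I)) : idealGraph Λ I ≠ ⊤ := by
  intro hG
  have : Nonempty (Vertex Λ I) :=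
    (ENat.one_le_card_iff_nonempty _).mp ((by norm_num : (1 : ℕ∞) ≤ 3).trans hcard)
  obtain ⟨m, hm⟩ := hI.exists_forall_add_eq
  have hdouble {x : Vertex Λ I} (hx : x ≠ m) : (x : ℕ) + x = m := by
    obtain ⟨s, hs, hadd⟩ := hm x
    exact hI.1.add_self_eq_of_idealGraph_eq_top hG hx hs hadd
  obtain ⟨a, ham, -⟩ := ENat.exists_ne_ne_of_three_le hcard m m
  obtain ⟨b, hbm, hba⟩ := ENat.exists_ne_ne_of_three_le hcard m a
  have ha := hdouble ham
  have hb := hdouble hbm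
  exact hba (Subtype.ext (by omega))

theorem IsIrreducibleIdeal.isPlanar_idealGraph (hI : IsIrreducibleIdeal Λ I)
    (hcard : ENat.card (Vertex Λ I) ≤ 5) : IsPlanar (idealGraph Λ I) := by
  have : Finite (Vertex Λ I) := ENat.card_lt_top.mp (hcard.trans_lt (ENat.natCast_lt_top 5))
  rw [ENat.card_eq_coe_natCard] at hcard
  have hcard : Nat.card (Vertex Λ I) ≤ 5 := by exact_mod_cast hcard
  rcases hcard.lt_or_eq with h4 | h5
  · exact isPlanar_of_card_le_four (Nat.le_of_lt_succ h4) _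
  · refine isPlanar_of_card_eq_five_of_ne_top h5 (hI.idealGraph_ne_top ?_)
    rw [ENat.card_eq_coe_natCard, h5]
    norm_num

end IrreducibleIdeal

end NumSemigroup

open NumSemigroup in
theorem mainTheorem1_general {Λ : AddSubmonoid ℕ} {I : Set ℕ} (hI : IsIrreducibleIdeal Λ I)
    (h : ENat.card (Vertex Λ I) ≤ 5 ∨
      IsOfType (idealGraph Λ I) sixType1 ∨ IsOfType (idealGraph Λ I) sixType2 ∨
      IsOfType (idealGraph Λ I) sixType3 ∨ IsOfType (idealGraph Λ I) sixType4 ∨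
      IsOfType (idealGraph Λ I) sevenType1 ∨ IsOfType (idealGraph Λ I) sevenType2 ∨
      IsOfType (idealGraph Λ I) sevenType3) :
    IsPlanar (idealGraph Λ I) := by
  rcases h with h | h | h | h | h | h | h | h
  · exact hI.isPlanar_idealGraph h
  · exact isPlanar_sixType1.of_isOfType h
  · exact isPlanar_sixType2.of_isOfType h
  · exact isPlanar_sixType3.of_isOfType h
  · exact isPlanar_sixType4.of_isOfType h
  · exact isPlanar_sevenType1.of_isOfType h
  · exact isPlanar_sevenType2.of_isOfType h
  · exact isPlanar_sevenType3.of_isOfType h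

theorem mainTheorem1 (Λ : AddSubmonoid ℕ) (hΛ : NumSemigroup.IsNumericalSemigroup Λ)
    (hdim : 2 ≤ NumSemigroup.embeddingDimension Λ)
    (I : Set ℕ) (hI : NumSemigroup.IsIrreducibleIdeal Λ I)
    (h : ENat.card (NumSemigroup.Vertex Λ I) ≤ 5 ∨
      (ENat.card (NumSemigroup.Vertex Λ I) = 6 ∧
        (NumSemigroup.IsOfType (NumSemigroup.idealGraph Λ I) NumSemigroup.sixType1 ∨
         NumSemigroup.IsOfType (NumSemigroup.idealGraph Λ I) NumSemigroup.sixType2 ∨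
         NumSemigroup.IsOfType (NumSemigroup.idealGraph Λ I) NumSemigroup.sixType3 ∨
         NumSemigroup.IsOfType (NumSemigroup.idealGraph Λ I) NumSemigroup.sixType4)) ∨
      (ENat.card (NumSemigroup.Vertex Λ I) = 7 ∧
        (NumSemigroup.IsOfType (NumSemigroup.idealGraph Λ I) NumSemigroup.sevenType1 ∨
         NumSemigroup.IsOfType (NumSemigroup.idealGraph Λ I) NumSemigroup.sevenType2 ∨
         NumSemigroup.IsOfType (NumSemigroup.idealGraph Λ I) NumSemigroup.sevenType3))) :
    NumSemigroup.IsPlanar (NumSemigroup.idealGraph Λ I) := by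
  exact mainTheorem1_general hI (by tauto)
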